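/- Model. Let $\rho\ge 1$ be an integer. In the KT-$\rho$ \textsc{Congest} model the communication network is a simple graph $G$ on $n$ nodes (not necessarily connected) of maximum degree $\Delta$; the nodes carry distinct IDs from a set of $N$ IDs, where $n\le N\le n^{a}$ for a constant $a$. Initially each node $v$ knows its own ID, the IDs of all nodes at distance at most $\rho$ from $v$, the neighborhood of every node at distance at most $\rho-1$ from $v$, and the numbers $n$ and $\Delta$. Each node has private random coins, independent of those of the other nodes. In each synchronous round every node may send to each of its neighbors a message of at most $\beta\log_2 n$ bits, for a constant $\beta$. The messages a node sends and its current output in a round may be an arbitrary function of its initial knowledge, its coins and the messages received so far (the algorithm need not be comparison-based); the number of rounds is not restricted, and the result of an execution is the assignment of outputs reached if the output of every node is eventually constant. A (randomized Monte Carlo) algorithm computes an MIS (respectively, a $(\Delta+1)$-coloring) with probability at least $p$ if, for every $n$-node graph $G$ and every assignment of distinct IDs, with probability at least $p$ over the coins the result of the execution is a maximal independent set of $G$ (respectively, a proper vertex coloring of $G$ with colors from $\{0,\dots,\Delta\}$). Theorem. For every integer constant $\rho\ge 1$ there are constants $c>0$ and $n_0$, depending only on $\rho$, such that for all $n\ge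 n_0$, all constants $a,\beta$, and all ID space sizes $N$ with $n\le N\le n^a$, the following holds. Every randomized algorithm for $n$-node graphs in the KT-$\rho$ \textsc{Congest} model that computes an MIS with probability at least $5/8$ has, on some $n$-node graph with some assignment of distinct IDs, an expected total number of messages (over all nodes and all rounds) of at least $c\,n$. The same holds for every randomized algorithm that computes a $(\Delta+1)$-coloring with probability at least $5/8$. -/

import Mathlib

open MeasureTheory Filter
open scoped ENNReal

/-- A message: a string of at most `b` bits. -/
abbrev Message (b : ℕ) : Type := {l : List Bool // l.length ≤ b}

/-- What a node receives in one round: the pairs (ID of a neighbour, message received from it). -/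
abbrev Inbox (N b : ℕ) : Type := Set (Fin N × Message b)

/-- The initial knowledge of a node; IDs are elements of `Fin N`. -/
structure Knowledge (N : ℕ) where
  /-- the node's own ID -/
  self : Fin N
  /-- the IDs of all nodes within distance `ρ` -/
  ids : Set (Fin N)
  /-- for the ID of a node within distance `ρ - 1`, the IDs of all its neighbours (`∅` otherwise) -/
  nbhd : Fin N → Set (Fin N)
  /-- the maximum degree of the network -/
  maxDeg : ℕ

open Classical in
/-- The initial knowledge of node `v` in the KT-`ρ` model (`1 ≤ ρ`) on the network `G` with ID
assignment `ids`: (i) the IDs of all nodes at distance at most `ρ`, (ii) the neighbourhood of every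
node at distance at most `ρ - 1`, i.e. less than `ρ`. The maximum degree is provided in addition;
the number of nodes is known as well, because algorithms are chosen separately for each size. The
extended distance `edist` is infinite between different components. -/
noncomputable def initialKnowledge {n N : ℕ} (ρ : ℕ) (G : SimpleGraph (Fin n))
    (ids : Fin n ↪ Fin N) (v : Fin n) : Knowledge N where
  self := ids v
  ids := {x | ∃ u, G.edist v u ≤ ρ ∧ ids u = x}
  nbhd := fun x => {y | ∃ u w, G.edist v u < ρ ∧ G.Adj u w ∧ ids u = x ∧ ids w = y}
  maxDeg := G.maxDegree

/-- A randomized synchronous message-passing algorithm with IDs in `Fin N`, messages of at most `b`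
bits and outputs in `O`, run by every node. Each node owns private coins: a point of `Coin`, drawn
according to `coinLaw` independently of the other nodes. At any time, the local state of a node is
all that it has seen: its initial knowledge, its coins, and the list of its inboxes in the rounds so
far (so the length of that list is the number of completed rounds). Local computation is arbitrary.

* `send K c h y` is the message, if any, sent in the current round to the neighbour with ID `y`
  (it has no effect if there is no such neighbour).
* `output K c h` is the current output.

The last two fields say that the behaviour is a random variable: it depends measurably on the
coins. -/
structure CongestAlgorithm (N b : ℕ) (O : Type) where
  Coin : Type
  [coinSpace : MeasurableSpace Coin]
  coinLaw : Measure Coin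
  [coinProb : IsProbabilityMeasure coinLaw]
  send : Knowledge N → Coin → List (Inbox N b) → Fin N → Option (Message b)
  output : Knowledge N → Coin → List (Inbox N b) → O
  measurable_send : ∀ K h y m, MeasurableSet {c | send K c h y = m}
  measurable_output : ∀ K h o, MeasurableSet {c | output K c h = o}

attribute [instance] CongestAlgorithm.coinSpace CongestAlgorithm.coinProb

namespace CongestAlgorithm

variable {n N b : ℕ} {O : Type}

/-- The inboxes of node `v` in the first `t` rounds of the execution of `A` in the KT-`ρ` model on
the network `G` with ID assignment `ids` and coins `ω`. -/
noncomputable def history (A : CongestAlgorithm N b O) (ρ : ℕ) (G : SimpleGraph (Fin n))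
    (ids : Fin n ↪ Fin N) (ω : Fin n → A.Coin) : ℕ → Fin n → List (Inbox N b)
  | 0, _ => []
  | t + 1, v => history A ρ G ids ω t v ++
      [{p | ∃ u, G.Adj u v ∧ ids u = p.1 ∧
        A.send (initialKnowledge ρ G ids u) (ω u) (history A ρ G ids ω t u) (ids v) = some p.2}]

/-- Node `u` sends a message to its neighbour `v` in round `t + 1`. -/
def Sends (A : CongestAlgorithm N b O) (ρ : ℕ) (G : SimpleGraph (Fin n))
    (ids : Fin n ↪ Fin N) (ω : Fin n → A.Coin) (t : ℕ) (u v : Fin n) : Prop :=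
  G.Adj u v ∧
    A.send (initialKnowledge ρ G ids u) (ω u) (A.history ρ G ids ω t u) (ids v) ≠ none

open Classical in
/-- The total number of messages sent by all nodes in all rounds (possibly infinite). -/
noncomputable def messageCount (A : CongestAlgorithm N b O) (ρ : ℕ) (G : SimpleGraph (Fin n))
    (ids : Fin n ↪ Fin N) (ω : Fin n → A.Coin) : ℝ≥0∞ :=
  ∑' t : ℕ, ∑ u : Fin n, ∑ v : Fin n, if A.Sends ρ G ids ω t u v then 1 else 0

/-- The expected total number of messages, over the independent coins of the nodes. -/
noncomputable def expectedMessages (A : CongestAlgorithm N b O) (ρ : ℕ) (G : SimpleGraph (Fin n))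
    (ids : Fin n ↪ Fin N) : ℝ≥0∞ :=
  ∫⁻ ω, A.messageCount ρ G ids ω ∂(Measure.pi fun _ : Fin n => A.coinLaw)

/-- In the execution with coins `ω`, the output of each node `v` is `out v` from some round on. An
algorithm whose nodes halt with irrevocable outputs is the special case in which a halted node
sends nothing and keeps its output. -/
def Computes (A : CongestAlgorithm N b O) (ρ : ℕ) (G : SimpleGraph (Fin n))
    (ids : Fin n ↪ Fin N) (ω : Fin n → A.Coin) (out : Fin n → O) : Prop :=
  ∀ v, ∀ᶠ t in atTop, A.output (initialKnowledge ρ G ids v) (ω v) (A.history ρ G ids ω t v) = out v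

/-- On every `n`-node network and every assignment of distinct IDs, the algorithm `A` computes, with
probability at least `p`, an output that is correct for the problem `P`. -/
def SolvesWithProb (A : CongestAlgorithm N b O) (ρ n : ℕ)
    (P : SimpleGraph (Fin n) → (Fin n → O) → Prop) (p : ℝ≥0∞) : Prop :=
  ∀ (G : SimpleGraph (Fin n)) (ids : Fin n ↪ Fin N),
    p ≤ (Measure.pi fun _ : Fin n => A.coinLaw) {ω | ∃ out, A.Computes ρ G ids ω out ∧ P G out}

end CongestAlgorithm

/-- The nodes with output `true` form a maximal independent set. -/
def IsMISOutput {n : ℕ} (G : SimpleGraph (Fin n)) (out : Fin n → Bool) : Prop :=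
  Maximal G.IsIndepSet {v | out v = true}

open Classical in
/-- The output is a proper vertex coloring with the `Δ + 1` colors `0, …, Δ`, where `Δ` is the
maximum degree. -/
def IsColoringOutput {n : ℕ} (G : SimpleGraph (Fin n)) (out : Fin n → ℕ) : Prop :=
  (∀ v, out v < G.maxDegree + 1) ∧ ∀ u v, G.Adj u v → out u ≠ out v

/-! The hard network is a disjoint union of `n / k` cycles of constant length `k`; each cycle keeps
its own block of IDs, and only their arrangement varies. In a silent execution a node's output
depends on its coins and its ball. Once coins are attached to IDs, the two outputs on an edge are
determined by the `2 * ρ + 2` consecutive IDs around it. An MIS or a coloring turns such pairs into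
a proper 3-coloring of the cycle; success on all arrangements would 3-color a shift graph, which is
impossible for large `k` (`exists_strictMono_init_eq_tail`, `exists_perm_conflict`).

Hence every coin vector fails for some arrangement, and averaging over permutations gives each cycle
one arrangement whose silent outputs are wrong with probability at least `1 / k!`
(`exists_perm_le_measure`). With these arrangements, a correct run has no cycle that is both silent
and wrong. Cycles are independent, so success probability `5 / 8 > 1 / e` forces the probabilities
of "silent and wrong" to sum to at most 1 (`sum_le_one_of_le_prod`). The probabilities that a cycle
sends then sum to at least `m / k! - 1` with `m = n / k`, which is linear in `n` and bounds the
expected number of messages from below. -/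

/-! ### Shift graphs -/

/-- A coloring of the strictly increasing `(w + 1)`-tuples of a long enough interval with boundedly
many colors gives the same color to two consecutive windows of some strictly increasing
`(w + 2)`-tuple: shift graphs have unbounded chromatic number. -/
theorem exists_strictMono_init_eq_tail (w : ℕ) : ∀ q : ℕ, ∃ k₀ : ℕ, ∀ k ≥ k₀,
    ∀ (C : Type) [Fintype C], Fintype.card C ≤ q → ∀ c : (Fin (w + 1) → Fin k) → C,
      ∃ x : Fin (w + 2) → Fin k, StrictMono x ∧ c (Fin.init x) = c (Fin.tail x) := by
  classical
  induction w with
  | zero =>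
    intro q
    refine ⟨q + 1, fun k hk C _ hC c => ?_⟩
    obtain ⟨a, b, hab, h⟩ : ∃ a b : Fin k, a < b ∧ c (fun _ => a) = c (fun _ => b) := by
      obtain ⟨a, b, hne, h⟩ := Fintype.exists_ne_map_eq_of_card_lt
        (fun a : Fin k => c (fun _ => a)) (by rw [Fintype.card_fin]; omega)
      rcases lt_or_gt_of_ne hne with hlt | hlt
      · exact ⟨a, b, hlt, h⟩
      · exact ⟨b, a, hlt, h.symm⟩
    refine ⟨![a, b], ?_, ?_⟩
    · rw [Fin.strictMono_iff_lt_succ]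
      intro i
      fin_cases i
      simpa using hab
    · convert h using 2
      · ext i; fin_cases i; rfl
      · ext i; fin_cases i; rfl
  | succ w ih =>
    intro q
    obtain ⟨k₀, hk₀⟩ := ih (2 ^ q)
    refine ⟨k₀, fun k hk C _ hC c => ?_⟩
    -- Color a shorter tuple by the set of colors of its increasing one-step extensions; this costs
    -- `2 ^ q` colors.
    obtain ⟨x, hx, hxe⟩ := hk₀ k hk (Set C)
      (by rw [Fintype.card_set]; exact Nat.pow_le_pow_right two_pos hC)
      (fun z => {d | ∃ y, StrictMono (Fin.snoc z y : Fin (w + 2) → Fin k) ∧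
        c (Fin.snoc z y : Fin (w + 2) → Fin k) = d})
    have hmem : c x ∈ {d | ∃ y, StrictMono (Fin.snoc (Fin.init x) y : Fin (w + 2) → Fin k) ∧
        c (Fin.snoc (Fin.init x) y : Fin (w + 2) → Fin k) = d} :=
      ⟨x (Fin.last _), by rwa [Fin.snoc_init_self], by rw [Fin.snoc_init_self]⟩
    rw [hxe] at hmem
    obtain ⟨y, hy, hcy⟩ := hmem
    refine ⟨Fin.snoc x y, ?_, ?_⟩
    · rw [Fin.strictMono_iff_lt_succ] at hx hy ⊢
      intro i
      induction i using Fin.lastCases with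
      | last =>
        have := hy (Fin.last _)
        rw [Fin.snoc_castSucc, Fin.succ_last, Fin.snoc_last] at this
        rw [Fin.snoc_castSucc, Fin.succ_last, Fin.snoc_last]
        exact this
      | cast i =>
        rw [Fin.snoc_castSucc, Fin.succ_castSucc, Fin.snoc_castSucc]
        exact hx i
    · rw [Fin.init_snoc, ← hcy]
      congr 1
      conv_rhs => rw [← Fin.cons_self_tail x, ← Fin.cons_snoc_eq_snoc_cons, Fin.tail_cons]

/-! ### Local rules on labelled cycles -/

theorem exists_perm_extending {w k : ℕ} (h : w ≤ k) (x : Fin w → Fin k)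
    (hx : Function.Injective x) :
    ∃ s : Equiv.Perm (Fin k), ∀ p : Fin w, s (Fin.castLE h p) = x p := by
  have := Equiv.Perm.isMultiplyPretransitive (Fin k) w
  obtain ⟨s, hs⟩ := MulAction.exists_smul_eq (Equiv.Perm (Fin k)) (Fin.castLEEmb h)
    (⟨x, hx⟩ : Fin w ↪ Fin k)
  exact ⟨s, fun p => DFunLike.congr_fun hs p⟩

/-- The rotation of the cycle `Fin k` by one step. -/
abbrev cycleRotation (k : ℕ) [NeZero k] : Equiv.Perm (Fin k) := Equiv.addRight 1

theorem val_add_one_of_lt {k : ℕ} [NeZero k] (j : Fin k) (h : j.val + 1 < k) :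
    (j + 1).val = j.val + 1 := by
  rw [Fin.val_add, Fin.val_one', Nat.add_mod_mod, Nat.mod_eq_of_lt h]

theorem val_sub_one_of_pos {k : ℕ} [NeZero k] (j : Fin k) (h : 0 < (j + 1).val) :
    j.val + 1 = (j + 1).val := by
  by_cases hj : j.val + 1 < k
  · exact (val_add_one_of_lt j hj).symm
  · exfalso
    have hj' : j.val + 1 = k := by omega
    rw [Fin.val_add, Fin.val_one', Nat.add_mod_mod, hj', Nat.mod_self] at h
    omega

/-- An assignment of outputs to the labelled cycles of length `k` that commutes with rotations and
is determined, at two adjacent positions, by the labels within distance `ρ`, violates on some cycle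
a condition that yields a proper 3-coloring. -/
theorem exists_perm_conflict {O : Type*} (ρ k : ℕ) [NeZero k] (hk : 2 * ρ + 4 ≤ k)
    (hshift : ∀ c : (Fin (2 * ρ + 2) → Fin k) → Fin 3,
      ∃ x : Fin (2 * ρ + 3) → Fin k, StrictMono x ∧ c (Fin.init x) = c (Fin.tail x))
    (col : O → O → Fin 3) (g : Equiv.Perm (Fin k) → Fin k → O)
    (hloc : ∀ s s' (j : Fin k), ρ ≤ j.val → j.val ≤ ρ + 1 →
      (∀ p : Fin k, p.val ≤ 2 * ρ + 1 → s p = s' p) → g s j = g s' j)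
    (hrot : ∀ s j, g (s * cycleRotation k) j = g s (j + 1)) :
    ∃ s j, col (g s j) (g s (j + 1)) = col (g s (j + 1)) (g s (j + 1 + 1)) := by
  have hw : 2 * ρ + 2 ≤ k := by omega
  have hext : ∀ x : Fin (2 * ρ + 2) → Fin k, ∃ s : Equiv.Perm (Fin k), Function.Injective x →
      ∀ p, s (Fin.castLE hw p) = x p := fun x => by
    by_cases hx : Function.Injective x
    · obtain ⟨s, hs⟩ := exists_perm_extending hw x hx
      exact ⟨s, fun _ => hs⟩
    · exact ⟨1, fun h => absurd h hx⟩
  choose S hS using hext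
  let j₀ : Fin k := ⟨ρ, by omega⟩
  have hj₁ : (j₀ + 1).val = ρ + 1 := val_add_one_of_lt j₀ (by change ρ + 1 < k; omega)
  -- The balls of positions `ρ` and `ρ + 1` fill positions `0` to `2 * ρ + 1`, so the choice of the
  -- extension `S x` is immaterial.
  obtain ⟨x, hx, hc⟩ := hshift fun x => col (g (S x) j₀) (g (S x) (j₀ + 1))
  obtain ⟨s, hs⟩ := exists_perm_extending (by omega : 2 * ρ + 3 ≤ k) x hx.injective
  have hinit : Function.Injective (Fin.init x) := fun a b h =>
    Fin.castSucc_injective _ (hx.injective h)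
  have htail : Function.Injective (Fin.tail x) := fun a b h =>
    Fin.succ_injective _ (hx.injective h)
  have h1 : ∀ p : Fin k, p.val ≤ 2 * ρ + 1 → S (Fin.init x) p = s p := by
    intro p hp
    have := hS _ hinit ⟨p.val, by omega⟩
    have h' := hs ⟨p.val, by omega⟩
    exact this.trans h'.symm
  -- Rotation brings the second window to the place of the first.
  have h2 : ∀ p : Fin k, p.val ≤ 2 * ρ + 1 → S (Fin.tail x) p = (s * cycleRotation k) p := by
    intro p hp
    have := hS _ htail ⟨p.val, by omega⟩
    have h' := hs ⟨p.val + 1, by omega⟩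
    refine this.trans (h'.symm.trans ?_)
    rw [Equiv.Perm.mul_apply]
    congr 1
    apply Fin.ext
    exact (val_add_one_of_lt p (by omega)).symm
  refine ⟨s, j₀, ?_⟩
  have e0 : ρ ≤ j₀.val ∧ j₀.val ≤ ρ + 1 := ⟨le_rfl, Nat.le_succ _⟩
  have e1 : ρ ≤ (j₀ + 1).val ∧ (j₀ + 1).val ≤ ρ + 1 := by omega
  rwa [hloc _ _ j₀ e0.1 e0.2 h1, hloc _ _ _ e1.1 e1.2 h1, hloc _ _ j₀ e0.1 e0.2 h2,
    hloc _ _ _ e1.1 e1.2 h2, hrot, hrot] at hc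

/-! ### Locality and symmetry of the initial knowledge -/

section Knowledge

variable {n N ρ : ℕ} {G : SimpleGraph (Fin n)}

/-- The initial knowledge of a node is determined by the IDs in its ball. -/
theorem initialKnowledge_congr {ids ids' : Fin n ↪ Fin N} {v : Fin n}
    (h : ∀ u, G.edist v u ≤ ρ → ids u = ids' u) :
    initialKnowledge ρ G ids v = initialKnowledge ρ G ids' v := by
  have hnext : ∀ u w, G.edist v u < ρ → G.Adj u w → G.edist v w ≤ ρ := fun u w hu hw =>
    calc G.edist v w ≤ G.edist v u + G.edist u w := SimpleGraph.edist_triangle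
      _ = G.edist v u + 1 := by rw [SimpleGraph.edist_eq_one_iff_adj.2 hw]
      _ ≤ ρ := Order.add_one_le_of_lt hu
  unfold initialKnowledge
  congr 1
  · exact h v (by simp)
  · ext x
    exact exists_congr fun u => and_congr_right fun hu => by rw [h u hu]
  · ext x y
    refine exists_congr fun u => exists_congr fun w => and_congr_right fun hu =>
      and_congr_right fun hw => ?_
    rw [h u hu.le, h w (hnext u w hu hw)]

theorem edist_iso_apply (φ : G ≃g G) (u v : Fin n) : G.edist (φ u) (φ v) = G.edist u v := by
  have key : ∀ (ψ : G ≃g G) (u v : Fin n), G.edist (ψ u) (ψ v) ≤ G.edist u v := by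
    intro ψ u v
    by_cases h : G.edist u v = ⊤
    · rw [h]; exact le_top
    · obtain ⟨p, hp⟩ := SimpleGraph.exists_walk_of_edist_ne_top h
      rw [← hp, ← SimpleGraph.Walk.length_map ψ.toHom p]
      exact SimpleGraph.edist_le _
  refine le_antisymm (key φ u v) ?_
  simpa using key φ.symm (φ u) (φ v)

/-- The initial knowledge is invariant under graph automorphisms. -/
theorem initialKnowledge_iso (φ : G ≃g G) {ids ids' : Fin n ↪ Fin N}
    (h : ∀ u, ids' u = ids (φ u)) (v : Fin n) :
    initialKnowledge ρ G ids' v = initialKnowledge ρ G ids (φ v) := by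
  unfold initialKnowledge
  congr 1
  · exact h v
  · ext x
    refine φ.toEquiv.exists_congr fun u => ?_
    rw [h u, ← edist_iso_apply φ]; rfl
  · ext x y
    refine φ.toEquiv.exists_congr fun u => φ.toEquiv.exists_congr fun w => ?_
    rw [h u, h w, ← edist_iso_apply φ, ← φ.map_adj_iff]; rfl

end Knowledge

/-! ### The union of cycles and its ID assignments -/

section CycleUnion

variable {n m k N : ℕ}

/-- The permutation of the nodes that acts on the `i`-th cycle as `σ i`. -/
noncomputable def blockPerm (e : Fin m × Fin k ↪ Fin n) (σ : Fin m → Equiv.Perm (Fin k)) :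
    Equiv.Perm (Fin n) :=
  Equiv.Perm.viaEmbedding (Equiv.prodShear (Equiv.refl _) σ) e

theorem blockPerm_apply {e : Fin m × Fin k ↪ Fin n}
    (σ : Fin m → Equiv.Perm (Fin k)) (i : Fin m) (j : Fin k) :
    blockPerm e σ (e (i, j)) = e (i, σ i j) :=
  Equiv.Perm.viaEmbedding_apply _ _ _

theorem blockPerm_apply_of_notMem {e : Fin m × Fin k ↪ Fin n}
    (σ : Fin m → Equiv.Perm (Fin k)) {v : Fin n}
    (hv : v ∉ Set.range e) : blockPerm e σ v = v :=
  Equiv.Perm.viaEmbedding_apply_of_notMem _ _ _ hv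

/-- The ID assignment obtained from `base` by permuting the IDs of the `i`-th cycle by `σ i`. -/
noncomputable def blockIds (base : Fin n ↪ Fin N) (e : Fin m × Fin k ↪ Fin n)
    (σ : Fin m → Equiv.Perm (Fin k)) : Fin n ↪ Fin N :=
  (blockPerm e σ).toEmbedding.trans base

theorem blockIds_apply {e : Fin m × Fin k ↪ Fin n} (base : Fin n ↪ Fin N)
    (σ : Fin m → Equiv.Perm (Fin k)) (i : Fin m) (j : Fin k) :
    blockIds base e σ (e (i, j)) = base (e (i, σ i j)) :=
  congrArg base (blockPerm_apply σ i j)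

variable [NeZero k]

/-- The disjoint union of `m` cycles of length `k` on the range of `e`, the other nodes being
isolated. -/
def cycleUnion (e : Fin m × Fin k ↪ Fin n) : SimpleGraph (Fin n) where
  Adj u v := u ≠ v ∧ ∃ i j, (u = e (i, j) ∧ v = e (i, j + 1)) ∨ (u = e (i, j + 1) ∧ v = e (i, j))
  symm := ⟨fun u v ⟨hne, i, j, h⟩ => ⟨hne.symm, i, j, by tauto⟩⟩
  loopless := ⟨fun u h => h.1 rfl⟩

variable {e : Fin m × Fin k ↪ Fin n}

theorem cycleUnion_adj_exists {u v : Fin n} (h : (cycleUnion e).Adj u v) :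
    ∃ p, u = e p := by
  obtain ⟨-, i, j, ⟨h, -⟩ | ⟨h, -⟩⟩ := h <;> exact ⟨_, h⟩

theorem cycleUnion_adj_of {i : Fin m} {j : Fin k} {v : Fin n}
    (h : (cycleUnion e).Adj (e (i, j)) v) :
    ∃ j', v = e (i, j') ∧ (j' = j + 1 ∨ j = j' + 1) := by
  obtain ⟨-, i', j', ⟨h, h'⟩ | ⟨h, h'⟩⟩ := h <;>
  · obtain ⟨rfl, rfl⟩ := Prod.mk.inj (e.injective h)
    exact ⟨_, h', by tauto⟩

theorem cycleUnion_adj_succ (hk : 2 ≤ k) (i : Fin m) (j : Fin k) :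
    (cycleUnion e).Adj (e (i, j)) (e (i, j + 1)) := by
  refine ⟨fun h => ?_, i, j, Or.inl ⟨rfl, rfl⟩⟩
  have h1 : j = j + 1 := (Prod.mk.inj (e.injective h)).2
  have h2 : (1 : Fin k) = 0 := by simpa using h1
  have := congrArg Fin.val h2
  rw [Fin.val_one', Nat.mod_eq_of_lt (by omega)] at this
  simp at this

/-- A walk of length `r` in a cycle that cannot reach the seam changes the position by at most
`r`. -/
theorem cycleUnion_walk {u v : Fin n} (p : (cycleUnion e).Walk u v) :
    ∀ {i : Fin m} {j : Fin k}, u = e (i, j) → ∃ j', v = e (i, j') ∧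
      (p.length ≤ j.val → j.val + p.length < k →
        j.val ≤ j'.val + p.length ∧ j'.val ≤ j.val + p.length) := by
  induction p with
  | nil => exact fun {i j} h => ⟨j, h, by simp⟩
  | cons hadj p ih =>
    rintro i j rfl
    obtain ⟨j₁, rfl, hj⟩ := cycleUnion_adj_of hadj
    obtain ⟨j', rfl, h⟩ := ih rfl
    refine ⟨j', rfl, fun h1 h2 => ?_⟩
    rw [SimpleGraph.Walk.length_cons] at h1 h2 ⊢
    rcases hj with rfl | rfl
    · have := val_add_one_of_lt j (by omega)
      have := h (by omega) (by omega)
      omega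
    · have := val_sub_one_of_pos j₁ (by omega)
      have := h (by omega) (by omega)
      omega

theorem cycleUnion_ball {ρ : ℕ} {i : Fin m} {j : Fin k} {v : Fin n}
    (h : (cycleUnion e).edist (e (i, j)) v ≤ ρ) :
    ∃ j', v = e (i, j') ∧ (ρ ≤ j.val → j.val + ρ < k → j'.val ≤ j.val + ρ) := by
  obtain ⟨p, hp⟩ := SimpleGraph.exists_walk_of_edist_ne_top
    (ne_top_of_le_ne_top (ENat.natCast_ne_top ρ) h)
  obtain ⟨j', hv, hj⟩ := cycleUnion_walk p rfl
  have : p.length ≤ ρ := by rw [← hp] at h; exact_mod_cast h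
  refine ⟨j', hv, fun h1 h2 => ?_⟩
  have := hj (by omega) (by omega)
  omega

/-- The simultaneous rotation of all cycles. -/
noncomputable def rotationIso (e : Fin m × Fin k ↪ Fin n) : cycleUnion e ≃g cycleUnion e where
  toEquiv := blockPerm e fun _ => cycleRotation k
  map_rel_iff' := by
    have key : ∀ u i j, blockPerm e (fun _ => cycleRotation k) u = e (i, j + 1) ↔ u = e (i, j) := by
      intro u i j
      rw [← Equiv.apply_eq_iff_eq (blockPerm e fun _ => cycleRotation k) (y := e (i, j)),
        blockPerm_apply]
      rfl
    intro u v
    refine and_congr (not_congr (Equiv.apply_eq_iff_eq _)) (exists_congr fun i => ?_)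
    refine ((cycleRotation k).exists_congr fun j => ?_).symm
    simp only [Equiv.coe_addRight, key]

/-- The initial knowledge of the node at position `j` of the `i`-th cycle, when the IDs of that
cycle are permuted by `s`. -/
noncomputable def cycleKnowledge (ρ : ℕ) (base : Fin n ↪ Fin N) (e : Fin m × Fin k ↪ Fin n)
    (i : Fin m) (s : Equiv.Perm (Fin k)) (j : Fin k) : Knowledge N :=
  initialKnowledge ρ (cycleUnion e) (blockIds base e fun _ => s) (e (i, j))

variable (ρ : ℕ) (base : Fin n ↪ Fin N)

/-- Balls never leave their cycle, so the other arrangements do not matter. `cycleKnowledge` uses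
`s` on every cycle so that the simultaneous rotation applies to it. -/
theorem initialKnowledge_blockIds (σ : Fin m → Equiv.Perm (Fin k)) (i : Fin m) (j : Fin k) :
    initialKnowledge ρ (cycleUnion e) (blockIds base e σ) (e (i, j)) =
      cycleKnowledge ρ base e i (σ i) j := by
  refine initialKnowledge_congr fun u hu => ?_
  obtain ⟨j', rfl, -⟩ := cycleUnion_ball hu
  rw [blockIds_apply, blockIds_apply]

/-- The ball does not wrap around the seam, so it lies in positions `0` to `2 * ρ + 1`. -/
theorem cycleKnowledge_congr (hk : 2 * ρ + 4 ≤ k) (i : Fin m) {s s' : Equiv.Perm (Fin k)}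
    {j : Fin k} (h1 : ρ ≤ j.val) (h2 : j.val ≤ ρ + 1)
    (h : ∀ p : Fin k, p.val ≤ 2 * ρ + 1 → s p = s' p) :
    cycleKnowledge ρ base e i s j = cycleKnowledge ρ base e i s' j := by
  refine initialKnowledge_congr fun u hu => ?_
  obtain ⟨j', rfl, hj⟩ := cycleUnion_ball hu
  have := hj h1 (by omega)
  rw [blockIds_apply, blockIds_apply, h j' (by omega)]

theorem cycleKnowledge_rotate (i : Fin m) (s : Equiv.Perm (Fin k)) (j : Fin k) :
    cycleKnowledge ρ base e i (s * cycleRotation k) j = cycleKnowledge ρ base e i s (j + 1) := by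
  have hφ : rotationIso e (e (i, j)) = e (i, j + 1) := blockPerm_apply _ i j
  unfold cycleKnowledge
  rw [← hφ]
  refine initialKnowledge_iso (rotationIso e) (fun u => ?_) _
  change base (blockPerm e (fun _ => s * cycleRotation k) u) =
    base (blockPerm e (fun _ => s) (blockPerm e (fun _ => cycleRotation k) u))
  congr 1
  by_cases hu : u ∈ Set.range e
  · obtain ⟨⟨i, j⟩, rfl⟩ := hu
    simp only [blockPerm_apply, Equiv.Perm.mul_apply]
  · simp only [blockPerm_apply_of_notMem _ hu]

end CycleUnion

/-! ### Silent executions -/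

section Silent

variable {n m k N b : ℕ} {O : Type} [NeZero k] (A : CongestAlgorithm N b O) (ρ : ℕ)
  (base : Fin n ↪ Fin N) (e : Fin m × Fin k ↪ Fin n)

/-- The coins of the `i`-th cycle for which the outputs reached without any communication do not
exist or violate the condition `col`, when the IDs of that cycle are permuted by `s`. -/
def silentWrong (col : O → O → Fin 3) (i : Fin m) (s : Equiv.Perm (Fin k)) :
    Set (Fin k → A.Coin) :=
  {c | ¬ ∃ g : Fin k → O,
    (∀ j, ∀ᶠ t in atTop,
      A.output (cycleKnowledge ρ base e i s j) (c j) (List.replicate t ∅) = g j) ∧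
    ∀ j, col (g j) (g (j + 1)) ≠ col (g (j + 1)) (g (j + 1 + 1))}

/-- The coins of the `i`-th cycle for which some node, having received nothing so far, sends a
message, when the IDs of that cycle are permuted by `s`. -/
def silentSend (i : Fin m) (s : Equiv.Perm (Fin k)) : Set (Fin k → A.Coin) :=
  {c | ∃ t j j', (cycleUnion e).Adj (e (i, j)) (e (i, j')) ∧
    A.send (cycleKnowledge ρ base e i s j) (c j) (List.replicate t ∅) (base (e (i, s j'))) ≠ none}

theorem measurableSet_silentWrong [Countable O] (col : O → O → Fin 3) (i : Fin m)
    (s : Equiv.Perm (Fin k)) : MeasurableSet (silentWrong A ρ base e col i s) := by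
  simp only [silentWrong, eventually_atTop]
  -- Since `O` is countable, the existential over `g` is a countable union.
  refine measurableSet_setOfPred.2 (Measurable.not (Measurable.exists fun g => Measurable.and
    (Measurable.forall fun j => Measurable.exists fun t₀ => Measurable.forall fun t =>
      Measurable.imp measurable_const ?_) measurable_const))
  exact (measurableSet_setOfPred.1 (A.measurable_output _ _ _)).comp (measurable_pi_apply j)

theorem measurableSet_silentSend (i : Fin m) (s : Equiv.Perm (Fin k)) :
    MeasurableSet (silentSend A ρ base e i s) := by
  refine measurableSet_setOfPred.2 (Measurable.exists fun t => Measurable.exists fun j =>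
    Measurable.exists fun j' => Measurable.and measurable_const (Measurable.not ?_))
  exact (measurableSet_setOfPred.1 (A.measurable_send _ _ _ none)).comp (measurable_pi_apply j)

/-- Whatever coins are attached to the IDs of a cycle, without communication the algorithm fails
for some arrangement of the IDs. -/
theorem exists_perm_mem_silentWrong (hk : 2 * ρ + 4 ≤ k)
    (hshift : ∀ c : (Fin (2 * ρ + 2) → Fin k) → Fin 3,
      ∃ x : Fin (2 * ρ + 3) → Fin k, StrictMono x ∧ c (Fin.init x) = c (Fin.tail x))
    (col : O → O → Fin 3) (i : Fin m) (c : Fin k → A.Coin) :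
    ∃ s : Equiv.Perm (Fin k), (fun j => c (s j)) ∈ silentWrong A ρ base e col i s := by
  by_contra! hcon
  have hg : ∀ s : Equiv.Perm (Fin k), ∃ g : Fin k → O,
      (∀ j, ∀ᶠ t in atTop, A.output (cycleKnowledge ρ base e i s j) (c (s j))
        (List.replicate t ∅) = g j) ∧
      ∀ j, col (g j) (g (j + 1)) ≠ col (g (j + 1)) (g (j + 1 + 1)) := fun s =>
    not_not.1 (hcon s)
  choose g hg hcol using hg
  -- Coins travel with the IDs, so equal knowledge and equal ID give the same silent run and the
  -- same limit.
  have huniq : ∀ s s' j j', cycleKnowledge ρ base e i s j = cycleKnowledge ρ base e i s' j' →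
      s j = s' j' → g s j = g s' j' := by
    intro s s' j j' hK hs
    have h := hg s j
    rw [hK, hs] at h
    obtain ⟨t, h1, h2⟩ := (h.and (hg s' j')).exists
    exact h1.symm.trans h2
  obtain ⟨s, j, h⟩ := exists_perm_conflict ρ k hk hshift col g
    (fun s s' j h1 h2 h => huniq _ _ _ _ (cycleKnowledge_congr ρ base hk i h1 h2 h)
      (h j (by omega)))
    (fun s j => huniq _ _ _ _ (cycleKnowledge_rotate ρ base i s j) rfl)
  exact hcol s j h

variable {A ρ base e} {σ : Fin m → Equiv.Perm (Fin k)} {ω : Fin n → A.Coin} {i : Fin m}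

/-- As long as the nodes of a cycle with empty inboxes send nothing, their inboxes stay empty. -/
theorem history_eq_replicate
    (h : ∀ t, (∀ j, A.history ρ (cycleUnion e) (blockIds base e σ) ω t (e (i, j)) =
        List.replicate t ∅) →
      ∀ j v, ¬ A.Sends ρ (cycleUnion e) (blockIds base e σ) ω t (e (i, j)) v) (t : ℕ) :
    ∀ j, A.history ρ (cycleUnion e) (blockIds base e σ) ω t (e (i, j)) = List.replicate t ∅ := by
  induction t with
  | zero => exact fun j => rfl
  | succ t ih =>
    intro j
    rw [CongestAlgorithm.history, ih j, List.replicate_succ']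
    congr 2
    refine Set.eq_empty_of_forall_notMem ?_
    rintro p ⟨u, hadj, -, hsend⟩
    obtain ⟨j', rfl, -⟩ := cycleUnion_adj_of hadj.symm
    exact h t ih j' (e (i, j)) ⟨hadj, by rw [hsend]; exact Option.some_ne_none _⟩

theorem sends_iff_of_history_eq {t : ℕ} {j j' : Fin k}
    (h : A.history ρ (cycleUnion e) (blockIds base e σ) ω t (e (i, j)) = List.replicate t ∅) :
    A.Sends ρ (cycleUnion e) (blockIds base e σ) ω t (e (i, j)) (e (i, j')) ↔
      (cycleUnion e).Adj (e (i, j)) (e (i, j')) ∧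
        A.send (cycleKnowledge ρ base e i (σ i) j) (ω (e (i, j))) (List.replicate t ∅)
          (base (e (i, σ i j'))) ≠ none := by
  rw [CongestAlgorithm.Sends, h, initialKnowledge_blockIds, blockIds_apply]

theorem history_eq_replicate_of_notMem_silentSend
    (hω : (fun j => ω (e (i, j))) ∉ silentSend A ρ base e i (σ i)) (t : ℕ) (j : Fin k) :
    A.history ρ (cycleUnion e) (blockIds base e σ) ω t (e (i, j)) = List.replicate t ∅ := by
  refine history_eq_replicate (fun t ht j v hs => hω ?_) t j
  obtain ⟨j', rfl, -⟩ := cycleUnion_adj_of hs.1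
  exact ⟨t, j, j', (sends_iff_of_history_eq (ht j)).1 hs⟩

/-- `silentSend` concerns a hypothetical run. If the cycle really sent nothing, its run would be
that one, and the predicted message would be sent. -/
theorem exists_sends_of_mem_silentSend
    (hω : (fun j => ω (e (i, j))) ∈ silentSend A ρ base e i (σ i)) :
    ∃ t j v, A.Sends ρ (cycleUnion e) (blockIds base e σ) ω t (e (i, j)) v := by
  by_contra! hcon
  obtain ⟨t, j, j', h⟩ := hω
  exact hcon t j _ ((sends_iff_of_history_eq
    (history_eq_replicate (fun t _ => hcon t) t j)).2 h)

/-- If the execution has a correct result, then no cycle is silent with a wrong result. -/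
theorem notMem_silentWrong_diff_of_computes {col : O → O → Fin 3} {out : Fin n → O}
    (hout : A.Computes ρ (cycleUnion e) (blockIds base e σ) ω out)
    (hcol : ∀ j, col (out (e (i, j))) (out (e (i, j + 1))) ≠
      col (out (e (i, j + 1))) (out (e (i, j + 1 + 1)))) :
    (fun j => ω (e (i, j))) ∉
      silentWrong A ρ base e col i (σ i) \ silentSend A ρ base e i (σ i) := by
  rintro ⟨hw, hs⟩
  refine hw ⟨fun j => out (e (i, j)), fun j => ?_, hcol⟩
  filter_upwards [hout (e (i, j))] with t ht
  rwa [history_eq_replicate_of_notMem_silentSend hs, initialKnowledge_blockIds] at ht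

open Classical in
/-- The number of messages is at least the number of cycles that are not silent. -/
theorem sum_indicator_le_messageCount :
    ∑ i, (silentSend A ρ base e i (σ i)).indicator 1 (fun j => ω (e (i, j))) ≤
      A.messageCount ρ (cycleUnion e) (blockIds base e σ) ω := by
  unfold CongestAlgorithm.messageCount
  rw [Summable.tsum_finsetSum fun _ _ => ENNReal.summable]
  set f : Fin n → ℝ≥0∞ := fun u => ∑' t, ∑ v,
    if A.Sends ρ (cycleUnion e) (blockIds base e σ) ω t u v then 1 else 0
  calc _ ≤ ∑ i, ∑ j, f (e (i, j)) := Finset.sum_le_sum fun i _ => ?_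
    _ = ∑ p, f (e p) := (Fintype.sum_prod_type fun p => f (e p)).symm
    _ = ∑ u ∈ Finset.univ.map e, f u := (Finset.sum_map _ _ _).symm
    _ ≤ ∑ u, f u := Finset.sum_le_sum_of_subset (Finset.subset_univ _)
  refine Set.indicator_apply_le' (fun h => ?_) fun _ => zero_le
  obtain ⟨t, j, v, h⟩ := exists_sends_of_mem_silentSend h
  calc (1 : ℝ≥0∞) = if A.Sends ρ (cycleUnion e) (blockIds base e σ) ω t (e (i, j)) v
        then 1 else 0 := (if_pos h).symm
    _ ≤ ∑ v, if A.Sends ρ (cycleUnion e) (blockIds base e σ) ω t (e (i, j)) v then 1 else 0 :=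
      Finset.single_le_sum (f := fun v => if A.Sends ρ (cycleUnion e) (blockIds base e σ) ω t
        (e (i, j)) v then (1 : ℝ≥0∞) else 0) (fun _ _ => zero_le) (Finset.mem_univ v)
    _ ≤ f (e (i, j)) := ENNReal.le_tsum t
    _ ≤ _ := Finset.single_le_sum (f := fun j => f (e (i, j))) (fun _ _ => zero_le)
      (Finset.mem_univ j)

end Silent

/-! ### Independent coins -/

section Product

variable {X : Type*} [MeasurableSpace X] (μ : Measure X) [IsProbabilityMeasure μ]

/-- Restricting independent samples along an injection gives independent samples. -/
theorem map_comp_embedding_pi {α β : Type*} [Fintype α] [Fintype β] (e : α ↪ β) :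
    (Measure.pi fun _ : β => μ).map (fun ω p => ω (e p)) = Measure.pi fun _ : α => μ := by
  classical
  refine (Measure.pi_eq fun S hS => ?_).symm
  rw [Measure.map_apply (by fun_prop) (MeasurableSet.univ_pi hS)]
  -- Coordinates outside the range of `e` are unconstrained; the default `Set.univ` contributes a
  -- factor 1.
  have : (fun (ω : β → X) p => ω (e p)) ⁻¹' Set.univ.pi S =
      Set.univ.pi (Function.extend e S fun _ => Set.univ) := by
    ext ω
    simp only [Set.mem_preimage, Set.mem_univ_pi]
    refine ⟨fun h u => ?_, fun h p => by simpa [e.injective.extend_apply] using h (e p)⟩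
    by_cases hu : ∃ p, e p = u
    · obtain ⟨p, rfl⟩ := hu
      simpa [e.injective.extend_apply] using h p
    · rw [Function.extend_apply' _ _ _ hu]
      exact Set.mem_univ _
  rw [this, Measure.pi_pi]
  have h1 : ∏ u ∈ Finset.univ.map e, μ (Function.extend e S (fun _ => Set.univ) u) =
      ∏ u, μ (Function.extend e S (fun _ => Set.univ) u) := by
    refine Finset.prod_subset (Finset.subset_univ _) fun u _ hu => ?_
    rw [Function.extend_apply' _ _ _ (by simpa using hu)]
    exact measure_univ
  rw [← h1, Finset.prod_map]
  exact Finset.prod_congr rfl fun p _ => by rw [e.injective.extend_apply]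

variable {ι κ β : Type*} [Fintype κ] [Fintype β] (e : ι × κ ↪ β)

/-- Disjoint blocks of independent samples are independent. -/
theorem map_blocks_pi [Fintype ι] :
    (Measure.pi fun _ : β => μ).map (fun ω i j => ω (e (i, j))) =
      Measure.pi fun _ : ι => Measure.pi fun _ : κ => μ := by
  have h := Measure.infinitePi_map_curry (fun (_ : ι) (_ : κ) => μ)
  simp only [Measure.infinitePi_eq_pi] at h
  rw [← h, ← map_comp_embedding_pi μ e, Measure.map_map (MeasurableEquiv.measurable _)
    (by fun_prop)]
  rfl

theorem measure_pi_forall_block [Fintype ι] {S : ι → Set (κ → X)} (hS : ∀ i, MeasurableSet (S i)) :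
    (Measure.pi fun _ : β => μ) {ω | ∀ i, (fun j => ω (e (i, j))) ∈ S i} =
      ∏ i, (Measure.pi fun _ : κ => μ) (S i) := by
  rw [← Measure.pi_pi, ← map_blocks_pi μ e,
    Measure.map_apply (by fun_prop) (MeasurableSet.univ_pi hS)]
  congr 1
  ext ω
  simp

theorem measure_pi_block (i : ι) {S : Set (κ → X)} (hS : MeasurableSet S) :
    (Measure.pi fun _ : β => μ) {ω | (fun j => ω (e (i, j))) ∈ S} =
      (Measure.pi fun _ : κ => μ) S := by
  rw [← map_comp_embedding_pi μ ((Function.Embedding.sectR i κ).trans e),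
    Measure.map_apply (by fun_prop) hS]
  rfl

/-- If for every sample some permutation of it lies in the corresponding set, then one of these
sets has measure at least `1 / k!`. -/
theorem exists_perm_le_measure {k : ℕ} (W : Equiv.Perm (Fin k) → Set (Fin k → X))
    (hW : ∀ s, MeasurableSet (W s))
    (h : ∀ c : Fin k → X, ∃ s : Equiv.Perm (Fin k), (fun j => c (s j)) ∈ W s) :
    ∃ s, 1 / (k.factorial : ℝ) ≤ (Measure.pi fun _ : Fin k => μ).real (W s) := by
  by_contra! hcon
  set P := Measure.pi fun _ : Fin k => μ
  have hP : ∀ s : Equiv.Perm (Fin k), P.real {c | (fun j => c (s j)) ∈ W s} = P.real (W s) := by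
    intro s
    have : P.map (fun c j => c (s j)) = P := map_comp_embedding_pi μ s.toEmbedding
    rw [measureReal_def, measureReal_def]
    congr 1
    conv_rhs => rw [← this, Measure.map_apply (by fun_prop) (hW s)]
    rfl
  -- Union bound: by `h` these events cover the whole space.
  have hone : (1 : ℝ) ≤ ∑ s, P.real {c | (fun j => c (s j)) ∈ W s} := by
    refine le_trans (le_of_eq ?_) (measureReal_iUnion_fintype_le _)
    rw [← probReal_univ (μ := P)]
    congr 1
    exact (Set.eq_univ_of_forall fun c => Set.mem_iUnion.2 (h c)).symm
  have hlt : ∑ s, P.real {c | (fun j => c (s j)) ∈ W s} <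
      ∑ _s : Equiv.Perm (Fin k), 1 / (k.factorial : ℝ) :=
    Finset.sum_lt_sum_of_nonempty Finset.univ_nonempty fun s _ => by rw [hP]; exact hcon s
  rw [Finset.sum_const, Finset.card_univ, Fintype.card_perm, Fintype.card_fin, nsmul_eq_mul,
    mul_one_div_cancel (Nat.cast_ne_zero.2 k.factorial_ne_zero)] at hlt
  linarith

end Product

/-- If independent events of probabilities `1 - x i` all occur with probability at least `5 / 8`,
then the sum of the `x i` is at most `1`. -/
theorem sum_le_one_of_le_prod {ι : Type*} (s : Finset ι) (x : ι → ℝ) (h1 : ∀ i ∈ s, x i ≤ 1)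
    (h : 5 / 8 ≤ ∏ i ∈ s, (1 - x i)) : ∑ i ∈ s, x i ≤ 1 := by
  by_contra! hlt
  have h2 : ∏ i ∈ s, (1 - x i) ≤ Real.exp (-∑ i ∈ s, x i) := by
    rw [← Finset.sum_neg_distrib, Real.exp_sum]
    refine Finset.prod_le_prod (fun i hi => sub_nonneg.2 (h1 i hi)) fun i _ => ?_
    linarith [Real.add_one_le_exp (-x i)]
  have h3 : Real.exp (-∑ i ∈ s, x i) ≤ Real.exp (-1) := Real.exp_le_exp.2 (by linarith)
  have h4 : Real.exp (-1) < 5 / 8 := by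
    rw [Real.exp_neg, inv_lt_comm₀ (Real.exp_pos 1) (by norm_num)]
    linarith [Real.exp_one_gt_d9]
  linarith

/-! ### Counting the cycles that send -/

section LowerBound

variable {n m k N b : ℕ} {O : Type} [NeZero k] [Countable O]

/-- An algorithm for a problem that forces a 3-coloring of the cycles sends a message on a constant
fraction of the cycles, for some assignment of IDs. -/
theorem exists_le_expectedMessages (A : CongestAlgorithm N b O) (ρ : ℕ) (hk : 2 * ρ + 4 ≤ k)
    (hshift : ∀ c : (Fin (2 * ρ + 2) → Fin k) → Fin 3,
      ∃ x : Fin (2 * ρ + 3) → Fin k, StrictMono x ∧ c (Fin.init x) = c (Fin.tail x))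
    (base : Fin n ↪ Fin N) (e : Fin m × Fin k ↪ Fin n)
    (P : SimpleGraph (Fin n) → (Fin n → O) → Prop) (col : O → O → Fin 3)
    (hcol : ∀ out, P (cycleUnion e) out → ∀ i j, col (out (e (i, j))) (out (e (i, j + 1))) ≠
      col (out (e (i, j + 1))) (out (e (i, j + 1 + 1))))
    (hA : A.SolvesWithProb ρ n P (5 / 8)) :
    ∃ (G : SimpleGraph (Fin n)) (ids : Fin n ↪ Fin N),
      ENNReal.ofReal (m / k.factorial - 1) ≤ A.expectedMessages ρ G ids := by
  set μ := Measure.pi fun _ : Fin k => A.coinLaw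
  choose σ hσ using fun i => exists_perm_le_measure A.coinLaw (silentWrong A ρ base e col i)
    (measurableSet_silentWrong A ρ base e col i)
    (exists_perm_mem_silentWrong A ρ base e hk hshift col i)
  set W := fun i => silentWrong A ρ base e col i (σ i)
  set E := fun i => silentSend A ρ base e i (σ i)
  have hWm : ∀ i, MeasurableSet (W i) := fun i => measurableSet_silentWrong _ _ _ _ _ _ _
  have hEm : ∀ i, MeasurableSet (E i) := fun i => measurableSet_silentSend _ _ _ _ _ _
  refine ⟨cycleUnion e, blockIds base e σ, ?_⟩
  have hsucc : (5 / 8 : ℝ) ≤ ∏ i, (1 - μ.real (W i \ E i)) := by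
    have h := (hA (cycleUnion e) (blockIds base e σ)).trans (measure_mono
      (t := {ω | ∀ i, (fun j => ω (e (i, j))) ∈ (W i \ E i)ᶜ}) ?_)
    · rw [measure_pi_forall_block A.coinLaw e fun i => ((hWm i).diff (hEm i)).compl] at h
      have h' := ENNReal.toReal_mono
        (ENNReal.prod_ne_top fun i _ => measure_ne_top μ _) h
      rw [ENNReal.toReal_prod] at h'
      refine le_trans (by norm_num) (h'.trans_eq (Finset.prod_congr rfl fun i _ => ?_))
      exact probReal_compl_eq_one_sub ((hWm i).diff (hEm i))
    · rintro ω ⟨out, hout, hP⟩ i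
      exact notMem_silentWrong_diff_of_computes hout (hcol out hP i)
  have hD := sum_le_one_of_le_prod Finset.univ (fun i => μ.real (W i \ E i))
    (fun i _ => measureReal_le_one) hsucc
  -- A wrong cycle is either silent and wrong, or sends.
  have hsum : (m / k.factorial : ℝ) ≤ ∑ i, μ.real (W i \ E i) + ∑ i, μ.real (E i) := by
    rw [← Finset.sum_add_distrib]
    calc (m / k.factorial : ℝ) = ∑ _i : Fin m, 1 / (k.factorial : ℝ) := by simp [div_eq_mul_inv]
      _ ≤ _ := Finset.sum_le_sum fun i _ => (hσ i).trans ?_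
    refine le_trans (measureReal_mono ?_) (measureReal_union_le _ _)
    exact Set.subset_sdiff_union _ _
  calc ENNReal.ofReal (m / k.factorial - 1) ≤ ENNReal.ofReal (∑ i, μ.real (E i)) :=
        ENNReal.ofReal_le_ofReal (by linarith)
    _ = ∑ i, μ (E i) := by
        rw [ENNReal.ofReal_sum_of_nonneg fun _ _ => measureReal_nonneg]
        exact Finset.sum_congr rfl fun i _ => ofReal_measureReal
    _ = ∑ i, (Measure.pi fun _ : Fin n => A.coinLaw) {ω | (fun j => ω (e (i, j))) ∈ E i} :=
        Finset.sum_congr rfl fun i _ => (measure_pi_block A.coinLaw e i (hEm i)).symm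
    _ = ∑ i, ∫⁻ ω, (E i).indicator 1 (fun j => ω (e (i, j)))
          ∂(Measure.pi fun _ : Fin n => A.coinLaw) := by
        refine Finset.sum_congr rfl fun i _ => ?_
        exact (lintegral_indicator_one
          (measurableSet_preimage (f := fun (ω : Fin n → A.Coin) j => ω (e (i, j)))
            (by fun_prop) (hEm i))).symm
    _ = ∫⁻ ω, ∑ i, (E i).indicator 1 (fun j => ω (e (i, j)))
          ∂(Measure.pi fun _ : Fin n => A.coinLaw) := by
        refine (lintegral_finsetSum _ fun i _ => ?_).symm
        exact (measurable_one.indicator (hEm i)).comp (by fun_prop)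
    _ ≤ _ := lintegral_mono fun ω => sum_indicator_le_messageCount

end LowerBound

/-! ### From MIS and coloring to 3-colored cycles -/

section Problems

variable {n m k : ℕ} [NeZero k] {e : Fin m × Fin k ↪ Fin n}

open Classical in
theorem maxDegree_cycleUnion_le : (cycleUnion e).maxDegree ≤ 2 := by
  refine SimpleGraph.maxDegree_le_of_forall_degree_le _ _ fun v => ?_
  by_cases hv : ∃ u, (cycleUnion e).Adj v u
  · obtain ⟨u, hu⟩ := hv
    obtain ⟨⟨i, j⟩, rfl⟩ := cycleUnion_adj_exists hu
    rw [← SimpleGraph.card_neighborFinset_eq_degree]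
    refine (Finset.card_le_card (t := {e (i, j + 1), e (i, j - 1)}) fun w hw => ?_).trans
      Finset.card_le_two
    obtain ⟨j', rfl, rfl | rfl⟩ := cycleUnion_adj_of ((SimpleGraph.mem_neighborFinset _ _ _).1 hw)
    · simp
    · simp
  · push Not at hv
    rw [← SimpleGraph.card_neighborFinset_eq_degree, Finset.card_eq_zero.2]
    · exact Nat.zero_le _
    · exact Finset.eq_empty_of_forall_notMem fun w hw =>
        hv w ((SimpleGraph.mem_neighborFinset _ _ _).1 hw)

/-- The color of a node in a 3-coloring of a cycle, computed from a maximal independent set: `a` and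
`b` tell whether the predecessor and the node itself belong to the set. -/
def misColor (a b : Bool) : Fin 3 := if b then 0 else if a then 1 else 2

/-- Two consecutive colors 0 violate independence, two colors 2 mean three consecutive unselected
nodes and violate maximality, and two colors 1 are contradictory. -/
theorem misColor_ne_of_isMISOutput (hk : 2 ≤ k) {out : Fin n → Bool}
    (h : IsMISOutput (cycleUnion e) out) (i : Fin m) (j : Fin k) :
    misColor (out (e (i, j))) (out (e (i, j + 1))) ≠
      misColor (out (e (i, j + 1))) (out (e (i, j + 1 + 1))) := by
  have hind : ∀ u v, (cycleUnion e).Adj u v → out u = true → out v = true → False :=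
    fun u v hadj hu hv => h.prop hu hv hadj.ne hadj
  have hmax : out (e (i, j)) = true ∨ out (e (i, j + 1)) = true ∨
      out (e (i, j + 1 + 1)) = true := by
    by_contra! hcon
    have hind' : (cycleUnion e).IsIndepSet (insert (e (i, j + 1)) {v | out v = true}) := by
      have hnadj : ∀ v, out v = true → ¬ (cycleUnion e).Adj (e (i, j + 1)) v := ?_
      · exact Set.pairwise_insert.2
          ⟨h.prop, fun v hv _ => ⟨hnadj v hv, fun hadj => hnadj v hv hadj.symm⟩⟩
      intro v hv hadj
      obtain ⟨j', rfl, rfl | hj⟩ := cycleUnion_adj_of hadj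
      · exact hcon.2.2 hv
      · rw [← add_right_cancel hj] at hv
        exact hcon.1 hv
    exact hcon.2.1 (h.le_of_ge hind' (Set.subset_insert _ _) (Set.mem_insert _ _))
  have h1 := hind _ _ (cycleUnion_adj_succ (e := e) hk i j)
  have h2 := hind _ _ (cycleUnion_adj_succ (e := e) hk i (j + 1))
  revert h1 h2 hmax
  generalize out (e (i, j)) = x
  generalize out (e (i, j + 1)) = y
  generalize out (e (i, j + 1 + 1)) = z
  revert x y z
  decide

/-- As `Δ ≤ 2`, all colors are below 3 and reduction modulo 3 loses nothing. -/
theorem ofNat_ne_of_isColoringOutput (hk : 2 ≤ k) {out : Fin n → ℕ}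
    (h : IsColoringOutput (cycleUnion e) out) (i : Fin m) (j : Fin k) :
    Fin.ofNat 3 (out (e (i, j))) ≠ Fin.ofNat 3 (out (e (i, j + 1))) := by
  intro heq
  have hlt : ∀ v, out v < 3 := fun v =>
    (h.1 v).trans_le (Nat.succ_le_succ maxDegree_cycleUnion_le)
  refine h.2 _ _ (cycleUnion_adj_succ hk i j) ?_
  have := congrArg Fin.val heq
  simpa [Fin.ofNat, Nat.mod_eq_of_lt (hlt _)] using this

end Problems

/-- The factor 4 absorbs both the rounding of `n / k` and the subtracted 1. -/
theorem div_factorial_bound {k n : ℕ} (hk : 1 ≤ k) (hn : 4 * k * k.factorial ≤ n) :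
    1 / (4 * k * k.factorial : ℝ) * n ≤ (n / k : ℕ) / k.factorial - 1 := by
  have hf : 1 ≤ k.factorial := Nat.factorial_pos k
  have hk' : (1 : ℝ) ≤ k := by exact_mod_cast hk
  have hf' : (1 : ℝ) ≤ k.factorial := by exact_mod_cast hf
  have hn' : (4 * k * k.factorial : ℝ) ≤ n := by exact_mod_cast hn
  have hm : (n : ℝ) ≤ k * ((n / k : ℕ) + 1) := by
    have := (Nat.lt_mul_div_succ n (by omega : 0 < k)).le
    exact_mod_cast this
  rw [one_div_mul_eq_div, le_sub_iff_add_le, div_add_one (by positivity),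
    div_le_div_iff₀ (by positivity) (by positivity)]
  have h1 : (k : ℝ) ≤ k * k.factorial := le_mul_of_one_le_right (by positivity) hf'
  have h2 : (n + 4 * k * k.factorial : ℝ) ≤ 4 * k * (n / k : ℕ) := by linarith
  nlinarith

theorem mainTheorem6 (ρ : ℕ) (hρ : 1 ≤ ρ) :
    ∃ c : ℝ, 0 < c ∧ ∃ n₀ : ℕ, ∀ n : ℕ, n₀ ≤ n →
      ∀ a β N b : ℕ, n ≤ N → N ≤ n ^ a → b ≤ β * Nat.log 2 n →
        (∀ A : CongestAlgorithm N b Bool,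
          A.SolvesWithProb ρ n IsMISOutput (5 / 8) →
            ∃ (G : SimpleGraph (Fin n)) (ids : Fin n ↪ Fin N),
              ENNReal.ofReal (c * n) ≤ A.expectedMessages ρ G ids) ∧
        (∀ A : CongestAlgorithm N b ℕ,
          A.SolvesWithProb ρ n IsColoringOutput (5 / 8) →
            ∃ (G : SimpleGraph (Fin n)) (ids : Fin n ↪ Fin N),
              ENNReal.ofReal (c * n) ≤ A.expectedMessages ρ G ids) := by
  obtain ⟨k₀, hk₀⟩ := exists_strictMono_init_eq_tail (2 * ρ + 1) 3
  obtain ⟨k, hkk, hk⟩ : ∃ k, k₀ ≤ k ∧ 2 * ρ + 4 ≤ k :=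
    ⟨max k₀ (2 * ρ + 4), le_max_left _ _, le_max_right _ _⟩
  have : NeZero k := ⟨by omega⟩
  have hshift := hk₀ k hkk (Fin 3) (by simp)
  have hf : 0 < k.factorial := k.factorial_pos
  have hkpos : 0 < k := by omega
  refine ⟨1 / (4 * k * k.factorial), by positivity, 4 * k * k.factorial, ?_⟩
  intro n hn a β N b hN _ _
  -- The fewer than `k` leftover nodes stay isolated.
  let e : Fin (n / k) × Fin k ↪ Fin n :=
    finProdFinEquiv.toEmbedding.trans (Fin.castLEEmb (Nat.div_mul_le_self n k))
  have hbound := ENNReal.ofReal_le_ofReal (div_factorial_bound (by omega) hn)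
  refine ⟨fun A hA => ?_, fun A hA => ?_⟩
  · obtain ⟨G, ids, h⟩ := exists_le_expectedMessages A ρ hk hshift (Fin.castLEEmb hN) e _ misColor
      (fun _ h => misColor_ne_of_isMISOutput (by omega) h) hA
    exact ⟨G, ids, hbound.trans h⟩
  · obtain ⟨G, ids, h⟩ := exists_le_expectedMessages A ρ hk hshift (Fin.castLEEmb hN) e _
      (fun x _ => Fin.ofNat 3 x) (fun _ h => ofNat_ne_of_isColoringOutput (by omega) h) hA
    exact ⟨G, ids, hbound.trans h⟩
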